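/- Let $\mu$ be a Borel probability measure on $\mathbb{R}$ with bounded support, and let $a<b$ be such that $\operatorname{supp}\mu\subseteq[a,b]$. For a probability measure $\nu$ on $\mathbb{R}$ with distribution function $F_\nu(x)=\nu((-\infty,x])$ let $q_\nu(u)=\inf\{x: F_\nu(x)\ge u\}$, $u\in(0,1)$, be its quantile function, let $\varphi_\nu(\theta)=q_\nu(|\theta|/\pi)$ for $\theta\in(-\pi,\pi)$, let $a_k(\nu)=\frac1\pi\int_{-\pi}^{\pi}\varphi_\nu(\theta)\cos(k\theta)\,d\theta$ for $k\ge1$, and let the Gross map of $\nu$ be $G_\nu(z)=\sum_{k=1}^{\infty}a_k(\nu)z^k$, $z\in\mathbb{D}=\{|z|<1\}$. For $n\ge1$ let $x_k=a+\frac{b-a}{n}k$ $(0\le k\le n)$ be the uniform mesh of $[a,b]$ and let $$\mu_n=F_\mu(a)\,\delta_a+\sum_{k=1}^{n}\bigl(F_\mu(x_k)-F_\mu(x_{k-1})\bigr)\,\delta_{x_k}.$$ Write $G=G_\mu$ and $G_n=G_{\mu_n}$, and for $f$ analytic on $\mathbb{D}$ put $\|f\|_{H^p(\mathbb{D})}=\sup_{0\le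 r<1}\bigl(\frac1{2\pi}\int_0^{2\pi}|f(re^{i\theta})|^p\,d\theta\bigr)^{1/p}$. Then for every real $p>1$ the functions $G$ and $G_n$ $(n\ge1)$ are analytic on $\mathbb{D}$ with finite $H^p(\mathbb{D})$-norm, and $$\|G_n-G\|_{H^p(\mathbb{D})}=O\bigl(\tfrac1n\bigr)\qquad(n\to\infty),$$ that is, there is a constant $C<\infty$, independent of $n$, with $\|G_n-G\|_{H^p(\mathbb{D})}\le C/n$ for all $n\ge1$. -/

import Mathlib

open MeasureTheory ProbabilityTheory
open scoped NNReal ENNReal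

noncomputable section

namespace GrossMap

/-- The quantile function `q(u) = inf {x : F(x) ≥ u}` of a probability measure on `ℝ` with
cumulative distribution function `F` (meaningful for `u ∈ (0,1)`). -/
def quantile (μ : Measure ℝ) (u : ℝ) : ℝ :=
  sInf {x : ℝ | u ≤ cdf μ x}

/-- The even function `φ(θ) = q(|θ|/π)` on `(-π, π)`. -/
def phi (μ : Measure ℝ) (θ : ℝ) : ℝ :=
  quantile μ (|θ| / Real.pi)

/-- The `k`-th Fourier cosine coefficient `a_k = (1/π) ∫_{-π}^{π} φ(θ) cos(kθ) dθ`, `k ≥ 1`. -/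
def coeff (μ : Measure ℝ) (k : ℕ) : ℝ :=
  (1 / Real.pi) * ∫ θ in (-Real.pi)..Real.pi, phi μ θ * Real.cos (k * θ)

/-- The Gross map `G(z) = ∑_{k ≥ 1} a_k z^k` generated by `μ`, on the open unit disc. -/
def gross (μ : Measure ℝ) (z : ℂ) : ℂ :=
  ∑' k : ℕ, (coeff μ (k + 1) : ℂ) * z ^ (k + 1)

/-- The discretization `F(x₀) δ_{x₀} + ∑_{k=1}^n (F(x_k) - F(x_{k-1})) δ_{x_k}` of `μ` along the
mesh `x₀ < ⋯ < x_n`. The summation index is shifted by one. -/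
def discretize (μ : Measure ℝ) (x : ℕ → ℝ) (n : ℕ) : Measure ℝ :=
  ENNReal.ofReal (cdf μ (x 0)) • Measure.dirac (x 0) +
    ∑ k ∈ Finset.range n,
      ENNReal.ofReal (cdf μ (x (k + 1)) - cdf μ (x k)) • Measure.dirac (x (k + 1))

/-- The uniform mesh `x_k = a + ((b - a)/n) k`, `0 ≤ k ≤ n`, of `[a,b]`. -/
def uniformMesh (a b : ℝ) (n : ℕ) (k : ℕ) : ℝ :=
  a + (b - a) / n * k

/-- The Hardy norm
`sup_{0 ≤ r < 1} ((1/2π) ∫_0^{2π} |f(r e^{iθ})|^p dθ)^{1/p}`, with values in `[0,∞]`. -/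
def hardyNorm (p : ℝ) (f : ℂ → ℂ) : ℝ≥0∞ :=
  ⨆ r ∈ Set.Ico (0 : ℝ) 1,
    (ENNReal.ofReal (1 / (2 * Real.pi)) *
      ∫⁻ θ in Set.Ioc (0 : ℝ) (2 * Real.pi),
        ‖f ((r : ℂ) * Complex.exp ((θ : ℂ) * Complex.I))‖ₑ ^ p) ^ (1 / p)

/-- Membership in the Hardy space: analytic on the open unit disc, with finite Hardy norm. -/
def MemHardy (p : ℝ) (f : ℂ → ℂ) : Prop :=
  DifferentiableOn ℂ f (Metric.ball (0 : ℂ) 1) ∧ hardyNorm p f < ⊤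

end GrossMap

end

namespace GrossMap

/-! The measure `μ_n` arises from `μ` by rounding up to the mesh, so the two quantile functions
differ by at most `(b - a) / n` on `(0,1)` (`abs_quantile_discretize_sub_le`). The Gross map is
linear in `φ`, and it remains to bound it from `L^∞` to `H^p`.

Its real part is the integral of `φ` against a Poisson-type kernel, whence `|Re G| ≤ 2 sup |φ|`
(`abs_re_cosSeries_le`). The conjugate function is controlled without the Riesz theorem: if `|Re f|
≤ M`, then `Re cos (f / M)` dominates a multiple of `|f / M|^p`, while its mean over each circle is
its value at `0`, namely `1` (`hardyNorm_le_of_abs_re_le`). This works for every `p > 0`. -/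

/-! ### Hardy norms of functions with bounded real part. -/

theorem rpow_le_mul_exp {p x : ℝ} (hp : 0 < p) (hx : 0 ≤ x) :
    x ^ p ≤ p ^ p * Real.exp x := by
  have h : x ≤ p * Real.exp (x / p) := by
    have h1 := Real.add_one_le_exp (x / p)
    have h2 : x = p * (x / p) := by field_simp
    nlinarith
  calc x ^ p ≤ (p * Real.exp (x / p)) ^ p := Real.rpow_le_rpow hx h hp.le
    _ = p ^ p * Real.exp x := by
      rw [Real.mul_rpow hp.le (Real.exp_pos _).le, ← Real.exp_mul, div_mul_cancel₀ _ hp.ne']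

theorem cos_re_eq (z : ℂ) : (Complex.cos z).re = Real.cos z.re * Real.cosh z.im := by
  rw [Complex.cos_eq]
  simp [← Complex.ofReal_cos, ← Complex.ofReal_sin, ← Complex.ofReal_cosh, ← Complex.ofReal_sinh]

/-- On a vertical strip of half-width one, powers of the modulus are controlled by `Re cos`. -/
theorem norm_rpow_le_re_cos {p : ℝ} (hp : 0 < p) {w : ℂ} (hw : |w.re| ≤ 1) :
    ‖w‖ ^ p ≤ p ^ p * (2 * Real.exp 1 / Real.cos 1) * (Complex.cos w).re := by
  have hc : 0 < Real.cos 1 := Real.cos_one_pos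
  have hcos : Real.cos 1 ≤ Real.cos w.re := by
    rw [← Real.cos_abs w.re]
    exact Real.cos_le_cos_of_nonneg_of_le_pi (abs_nonneg _) (by linarith [Real.pi_gt_three]) hw
  have hcosh : Real.exp |w.im| ≤ 2 * Real.cosh w.im := by
    rw [← Real.cosh_abs, Real.cosh_eq]
    linarith [Real.exp_pos (-|w.im|)]
  have hn : ‖w‖ ≤ 1 + |w.im| := (Complex.norm_le_abs_re_add_abs_im w).trans (by linarith)
  have hw0 : 0 ≤ Real.cos w.re := hc.le.trans hcos
  calc ‖w‖ ^ p ≤ p ^ p * Real.exp ‖w‖ := rpow_le_mul_exp hp (norm_nonneg _)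
    _ ≤ p ^ p * Real.exp (1 + |w.im|) := by gcongr
    _ = p ^ p * (Real.exp 1 / Real.cos 1) * (Real.cos 1 * Real.exp |w.im|) := by
      rw [Real.exp_add]; field_simp
    _ ≤ p ^ p * (Real.exp 1 / Real.cos 1) * (Real.cos w.re * (2 * Real.cosh w.im)) := by
      gcongr
    _ = p ^ p * (2 * Real.exp 1 / Real.cos 1) * (Complex.cos w).re := by
      rw [cos_re_eq]; ring

/-- An analytic function with real part bounded by `M` that vanishes at the origin has Hardy norm
bounded by a multiple of `M`. -/
theorem hardyNorm_le_of_abs_re_le {p : ℝ} (hp : 0 < p) {f : ℂ → ℂ} {M : ℝ} (hM : 0 < M)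
    (hf : DifferentiableOn ℂ f (Metric.ball 0 1)) (h0 : f 0 = 0)
    (hre : ∀ z ∈ Metric.ball (0 : ℂ) 1, |(f z).re| ≤ M) :
    hardyNorm p f ≤
      ENNReal.ofReal (p * (2 * Real.exp 1 / Real.cos 1) ^ (1 / p) * M) := by
  have hc : 0 < Real.cos 1 := Real.cos_one_pos
  set A : ℝ := 2 * Real.exp 1 / Real.cos 1 with hA
  have hA0 : 0 < A := by positivity
  refine iSup₂_le fun r hr => ?_
  have hmem : ∀ θ : ℝ, (r : ℂ) * Complex.exp (θ * Complex.I) ∈ Metric.ball (0 : ℂ) 1 := by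
    intro θ
    simpa [Complex.norm_exp_ofReal_mul_I, abs_of_nonneg hr.1] using hr.2
  set g : ℂ → ℂ := fun z => Complex.cos (f z / M) with hg
  have hgd : DifferentiableOn ℂ g (Metric.ball 0 1) := (hf.div_const _).ccos
  have hgc : Continuous fun θ : ℝ => g ((r : ℂ) * Complex.exp (θ * Complex.I)) :=
    hgd.continuousOn.comp_continuous (by fun_prop) hmem
  -- Mean value property, with `cos 0 = 1`.
  have hmean : (2 * Real.pi)⁻¹ *
      ∫ θ in (0 : ℝ)..2 * Real.pi, (g ((r : ℂ) * Complex.exp (θ * Complex.I))).re = 1 := by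
    have hsub : Metric.closedBall (0 : ℂ) |r| ⊆ Metric.ball 0 1 :=
      Metric.closedBall_subset_ball (by rw [abs_of_nonneg hr.1]; exact hr.2)
    have h1 : Real.circleAverage g 0 r = g 0 :=
      circleAverage_of_differentiable_on_off_countable Set.countable_empty
        (hgd.continuousOn.mono hsub) fun z hz => hgd.differentiableAt
          (Metric.isOpen_ball.mem_nhds (hsub (Metric.ball_subset_closedBall hz.1)))
    have h2 : g 0 = 1 := by simp [hg, h0]
    rw [h2, Real.circleAverage_def] at h1
    have h3 := congrArg Complex.re h1
    rw [Complex.smul_re, Complex.one_re] at h3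
    simp only [circleMap_zero] at h3
    rw [← h3, smul_eq_mul]
    congr 1
    exact Complex.reCLM.intervalIntegral_comp_comm (hgc.intervalIntegrable _ _)
  have hpt : ∀ θ : ℝ, ‖f ((r : ℂ) * Complex.exp (θ * Complex.I))‖ₑ ^ p ≤
      ENNReal.ofReal (M ^ p * (p ^ p * A) *
        (g ((r : ℂ) * Complex.exp (θ * Complex.I))).re) := by
    intro θ
    set w := f ((r : ℂ) * Complex.exp (θ * Complex.I)) with hw
    have hdiv : |(w / M).re| ≤ 1 := by
      rw [Complex.div_ofReal_re, abs_div, abs_of_pos hM, div_le_one hM]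
      exact hre _ (hmem θ)
    have h := norm_rpow_le_re_cos hp hdiv
    rw [← ofReal_norm, ENNReal.ofReal_rpow_of_nonneg (norm_nonneg _) hp.le]
    refine ENNReal.ofReal_le_ofReal ?_
    have hwn : ‖w‖ = M * ‖w / M‖ := by
      rw [norm_div, Complex.norm_real, Real.norm_of_nonneg hM.le]; field_simp
    rw [hwn, Real.mul_rpow hM.le (norm_nonneg _), mul_assoc]
    exact mul_le_mul_of_nonneg_left h (by positivity)
  have hnn : ∀ θ : ℝ, 0 ≤ M ^ p * (p ^ p * A) *
      (g ((r : ℂ) * Complex.exp (θ * Complex.I))).re := by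
    intro θ
    have h := norm_rpow_le_re_cos hp (w := f ((r : ℂ) * Complex.exp (θ * Complex.I)) / M) (by
      rw [Complex.div_ofReal_re, abs_div, abs_of_pos hM, div_le_one hM]
      exact hre _ (hmem θ))
    rw [mul_assoc]
    exact mul_nonneg (by positivity) ((by positivity : (0 : ℝ) ≤ _).trans h)
  have hint : ∫⁻ θ in Set.Ioc (0 : ℝ) (2 * Real.pi),
        ‖f ((r : ℂ) * Complex.exp ((θ : ℂ) * Complex.I))‖ₑ ^ p ≤
      ENNReal.ofReal (M ^ p * (p ^ p * A) * (2 * Real.pi)) := by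
    refine (lintegral_mono hpt).trans ?_
    rw [← ofReal_integral_eq_lintegral_ofReal _ (Filter.Eventually.of_forall hnn)]
    · refine ENNReal.ofReal_le_ofReal ?_
      rw [integral_const_mul, ← intervalIntegral.integral_of_le (by positivity)]
      have : (∫ θ in (0 : ℝ)..2 * Real.pi,
          (g ((r : ℂ) * Complex.exp (θ * Complex.I))).re) = 2 * Real.pi := by
        field_simp at hmean
        linarith
      rw [this]
    · refine Continuous.integrableOn_Ioc ?_
      exact continuous_const.mul (Complex.continuous_re.comp hgc)
  calc _ ≤ (ENNReal.ofReal (1 / (2 * Real.pi)) *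
        ENNReal.ofReal (M ^ p * (p ^ p * A) * (2 * Real.pi))) ^ (1 / p) := by gcongr
    _ = ENNReal.ofReal (p * A ^ (1 / p) * M) := by
      rw [← ENNReal.ofReal_mul (by positivity),
        ENNReal.ofReal_rpow_of_nonneg (by positivity) (by positivity)]
      congr 1
      have : 1 / (2 * Real.pi) * (M ^ p * (p ^ p * A) * (2 * Real.pi)) = M ^ p * (p ^ p * A) := by
        field_simp
      rw [this, Real.mul_rpow (by positivity) (by positivity),
        Real.mul_rpow (by positivity) (by positivity), one_div,
        Real.rpow_rpow_inv hM.le hp.ne', Real.rpow_rpow_inv hp.le hp.ne']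
      ring

/-! ### Quantile functions. -/

/-- Right continuity of the distribution function makes the infimum attained. Through this Galois
connection, comparisons of quantiles become comparisons of distribution functions. -/
theorem quantile_le_iff {μ : Measure ℝ} {u x : ℝ} (hne : ∃ y, u ≤ cdf μ y)
    (hbdd : BddBelow {y | u ≤ cdf μ y}) : quantile μ u ≤ x ↔ u ≤ cdf μ x := by
  refine ⟨fun h => ?_, fun h => csInf_le hbdd h⟩
  have hcont := (cdf μ).right_continuous x
  have htend : Filter.Tendsto (cdf μ) (nhdsWithin x (Set.Ioi x)) (nhds (cdf μ x)) :=
    hcont.mono_left (nhdsWithin_mono _ Set.Ioi_subset_Ici_self)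
  refine ge_of_tendsto htend ?_
  filter_upwards [self_mem_nhdsWithin] with y hy
  obtain ⟨z, hz, hzy⟩ := exists_lt_of_csInf_lt hne (lt_of_le_of_lt h hy)
  exact le_trans hz (monotone_cdf μ hzy.le)

theorem bddBelow_setOf_le_cdf (μ : Measure ℝ) {u : ℝ} (hu : 0 < u) :
    BddBelow {y | u ≤ cdf μ y} := by
  obtain ⟨c, hc⟩ := ((tendsto_cdf_atBot μ).eventually (gt_mem_nhds hu)).exists
  refine ⟨c, fun y hy => ?_⟩
  by_contra! h
  exact absurd (le_trans hy (monotone_cdf μ h.le)) (not_le.2 hc)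

theorem exists_le_cdf (μ : Measure ℝ) {u : ℝ} (hu : u < 1) : ∃ y, u ≤ cdf μ y := by
  obtain ⟨c, hc⟩ := ((tendsto_cdf_atTop μ).eventually (lt_mem_nhds hu)).exists
  exact ⟨c, hc.le⟩

theorem quantile_le_iff_of_mem_Ioo {μ : Measure ℝ} {u x : ℝ} (hu : u ∈ Set.Ioo (0 : ℝ) 1) :
    quantile μ u ≤ x ↔ u ≤ cdf μ x :=
  quantile_le_iff (exists_le_cdf μ hu.2) (bddBelow_setOf_le_cdf μ hu.1)

theorem monotoneOn_quantile (μ : Measure ℝ) : MonotoneOn (quantile μ) (Set.Ioo 0 1) := by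
  intro u hu v hv huv
  rw [quantile_le_iff_of_mem_Ioo hu]
  exact huv.trans ((quantile_le_iff_of_mem_Ioo hv).1 le_rfl)

theorem abs_div_pi_mem_Ioo {t : ℝ} (ht : t ∈ Set.Ioo (-Real.pi) Real.pi) (h0 : t ≠ 0) :
    |t| / Real.pi ∈ Set.Ioo (0 : ℝ) 1 :=
  ⟨by positivity, (div_lt_one Real.pi_pos).2 (abs_lt.2 ht)⟩

/-- Discards the null set where `u` is `0` or `1` and `sInf` may take its default value. -/
theorem ae_abs_div_pi_mem_Ioo :
    ∀ᵐ t ∂(volume.restrict (Set.Ioc (-Real.pi) Real.pi)), |t| / Real.pi ∈ Set.Ioo (0 : ℝ) 1 := by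
  have h1 : ∀ᵐ t : ℝ ∂(volume.restrict (Set.Ioc (-Real.pi) Real.pi)), t ≠ 0 :=
    Measure.ae_ne _ _
  have h2 : ∀ᵐ t : ℝ ∂(volume.restrict (Set.Ioc (-Real.pi) Real.pi)), t ≠ Real.pi :=
    Measure.ae_ne _ _
  filter_upwards [h1, h2, ae_restrict_mem measurableSet_Ioc] with t h0 hpi ht
  exact abs_div_pi_mem_Ioo ⟨ht.1, lt_of_le_of_ne ht.2 hpi⟩ h0

/-- `phi μ` is monotone on each side of `0`. -/
theorem aestronglyMeasurable_phi (μ : Measure ℝ) :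
    AEStronglyMeasurable (phi μ) (volume.restrict (Set.Ioc (-Real.pi) Real.pi)) := by
  have hpos : MonotoneOn (phi μ) (Set.Ioo 0 Real.pi) := by
    intro s hs t ht hst
    refine monotoneOn_quantile μ
      (abs_div_pi_mem_Ioo ⟨by linarith [hs.1, Real.pi_pos], hs.2⟩ hs.1.ne')
      (abs_div_pi_mem_Ioo ⟨by linarith [ht.1, Real.pi_pos], ht.2⟩ ht.1.ne') ?_
    rw [abs_of_pos hs.1, abs_of_pos ht.1]
    gcongr
  have hneg : AntitoneOn (phi μ) (Set.Ioo (-Real.pi) 0) := by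
    intro s hs t ht hst
    refine monotoneOn_quantile μ
      (abs_div_pi_mem_Ioo ⟨ht.1, by linarith [ht.2, Real.pi_pos]⟩ ht.2.ne)
      (abs_div_pi_mem_Ioo ⟨hs.1, by linarith [hs.2, Real.pi_pos]⟩ hs.2.ne) ?_
    rw [abs_of_neg hs.2, abs_of_neg ht.2]
    gcongr
  have hunion : AEMeasurable (phi μ)
      (volume.restrict (Set.Ioo (-Real.pi) 0 ∪ Set.Ioo 0 Real.pi)) :=
    aemeasurable_union_iff.2 ⟨aemeasurable_restrict_of_antitoneOn measurableSet_Ioo hneg,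
      aemeasurable_restrict_of_monotoneOn measurableSet_Ioo hpos⟩
  have hset : (Set.Ioc (-Real.pi) Real.pi : Set ℝ) =ᵐ[volume]
      (Set.Ioo (-Real.pi) 0 ∪ Set.Ioo 0 Real.pi : Set ℝ) := by
    filter_upwards [Measure.ae_ne volume (0 : ℝ), Measure.ae_ne volume Real.pi] with t h0 hpi
    refine propext ⟨fun h => ?_, fun h => ?_⟩
    · rcases lt_or_gt_of_ne h0 with h' | h'
      · exact Or.inl ⟨h.1, h'⟩
      · exact Or.inr ⟨h', lt_of_le_of_ne h.2 hpi⟩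
    · rcases h with h | h
      · exact ⟨h.1, by linarith [h.2, Real.pi_pos]⟩
      · exact ⟨by linarith [h.1, Real.pi_pos], h.2.le⟩
  rw [Measure.restrict_congr_set hset]
  exact hunion.aestronglyMeasurable

/-! ### Consequences of bounded support. -/

section Support

variable {μ : Measure ℝ} {a b : ℝ}

theorem measure_eq_zero_of_disjoint_support {X : Type*} [TopologicalSpace X]
    [HereditarilyLindelofSpace X] [MeasurableSpace X] {μ : Measure X} {s t : Set X}
    (hμ : μ.support ⊆ t) (hs : Disjoint s t) : μ s = 0 :=
  measure_mono_null (fun _ hx h => Set.disjoint_left.1 hs hx (hμ h)) Measure.measure_compl_support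

theorem cdf_eq_zero_of_lt [IsProbabilityMeasure μ] (hμ : μ.support ⊆ Set.Icc a b) {x : ℝ}
    (hx : x < a) : cdf μ x = 0 := by
  have h : μ (Set.Iic x) = 0 := measure_eq_zero_of_disjoint_support hμ
    (Set.disjoint_left.2 fun y hy hy' => absurd (hy'.1.trans hy) (not_le.2 hx))
  rw [cdf_eq_real, measureReal_def, h, ENNReal.toReal_zero]

theorem cdf_eq_one_of_le [IsProbabilityMeasure μ] (hμ : μ.support ⊆ Set.Icc a b) {x : ℝ}
    (hx : b ≤ x) : cdf μ x = 1 := by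
  have h : μ (Set.Iic x)ᶜ = 0 := measure_eq_zero_of_disjoint_support hμ
    (Set.disjoint_left.2 fun y hy hy' => hy (hy'.2.trans hx))
  rw [cdf_eq_real, measureReal_def, (prob_compl_eq_zero_iff measurableSet_Iic).1 h,
    ENNReal.toReal_one]

theorem quantile_mem_Icc [IsProbabilityMeasure μ] (hμ : μ.support ⊆ Set.Icc a b) {u : ℝ}
    (hu : u ∈ Set.Ioo (0 : ℝ) 1) : quantile μ u ∈ Set.Icc a b := by
  refine ⟨?_, ?_⟩
  · by_contra! h
    have := (quantile_le_iff_of_mem_Ioo (μ := μ) hu).1 le_rfl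
    rw [cdf_eq_zero_of_lt hμ h] at this
    exact absurd hu.1 (not_lt.2 this)
  · rw [quantile_le_iff_of_mem_Ioo hu, cdf_eq_one_of_le hμ le_rfl]
    exact hu.2.le

end Support

/-! ### Distribution function of the discretization. -/

section Discretize

variable {μ : Measure ℝ} {x : ℕ → ℝ}

theorem discretize_succ (μ : Measure ℝ) (x : ℕ → ℝ) (n : ℕ) :
    discretize μ x (n + 1) = discretize μ x n +
      ENNReal.ofReal (cdf μ (x (n + 1)) - cdf μ (x n)) • Measure.dirac (x (n + 1)) := by
  simp only [discretize, Finset.sum_range_succ, add_assoc]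

theorem discretize_zero (μ : Measure ℝ) (x : ℕ → ℝ) :
    discretize μ x 0 = ENNReal.ofReal (cdf μ (x 0)) • Measure.dirac (x 0) := by
  simp [discretize]

theorem ofReal_cdf_add_ofReal_sub (μ : Measure ℝ) {s t : ℝ} (h : s ≤ t) :
    ENNReal.ofReal (cdf μ s) + ENNReal.ofReal (cdf μ t - cdf μ s) = ENNReal.ofReal (cdf μ t) := by
  rw [← ENNReal.ofReal_add (cdf_nonneg μ s) (sub_nonneg.2 (monotone_cdf μ h)),
    add_sub_cancel]

theorem discretize_univ (hx : Monotone x) (n : ℕ) :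
    discretize μ x n Set.univ = ENNReal.ofReal (cdf μ (x n)) := by
  induction n with
  | zero => simp [discretize_zero]
  | succ n ih =>
    rw [discretize_succ, Measure.add_apply, ih, Measure.smul_apply, measure_univ, smul_eq_mul,
      mul_one, ofReal_cdf_add_ofReal_sub μ (hx n.le_succ)]

/-- The atoms up to `y` telescope. The minimum with `x n` keeps the induction exact: when a new atom
counts, the earlier mass must be bounded by `cdf μ (x n)`, not `cdf μ y`. -/
theorem discretize_Iic_le (hx : Monotone x) (n : ℕ) (y : ℝ) :
    discretize μ x n (Set.Iic y) ≤ ENNReal.ofReal (cdf μ (min y (x n))) := by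
  induction n with
  | zero =>
    rw [discretize_zero, Measure.smul_apply, Measure.dirac_apply' _ measurableSet_Iic]
    by_cases h : x 0 ≤ y <;> simp [h, Set.indicator]
  | succ n ih =>
    rw [discretize_succ, Measure.add_apply, Measure.smul_apply,
      Measure.dirac_apply' _ measurableSet_Iic]
    by_cases h : x (n + 1) ≤ y
    · rw [min_eq_right ((hx n.le_succ).trans h)] at ih
      simp only [Set.indicator, Set.mem_Iic, h, if_true, Pi.one_apply, smul_eq_mul, mul_one,
        min_eq_right]
      rw [← ofReal_cdf_add_ofReal_sub μ (hx n.le_succ)]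
      gcongr
    · simp only [Set.indicator, Set.mem_Iic, h, if_false, smul_zero, add_zero]
      refine ih.trans (ENNReal.ofReal_le_ofReal (monotone_cdf μ ?_))
      exact min_le_min le_rfl (hx n.le_succ)

theorem le_discretize_Iic (hx : Monotone x) {n j : ℕ} (hj : j ≤ n) {y : ℝ} (hy : x j ≤ y) :
    ENNReal.ofReal (cdf μ (x j)) ≤ discretize μ x n (Set.Iic y) := by
  induction n generalizing j with
  | zero =>
    obtain rfl : j = 0 := by omega
    simp [discretize_zero, Measure.dirac_apply' _ measurableSet_Iic, hy]
  | succ n ih =>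
    rw [discretize_succ, Measure.add_apply]
    rcases Nat.lt_or_ge n j with h | h
    · obtain rfl : j = n + 1 := by omega
      rw [← ofReal_cdf_add_ofReal_sub μ (hx n.le_succ)]
      refine add_le_add (ih le_rfl ((hx n.le_succ).trans hy)) ?_
      simp [Measure.dirac_apply' _ measurableSet_Iic, hy]
    · exact (ih h hy).trans le_self_add

end Discretize

/-! ### Rounding up to the uniform mesh. -/

section UniformMesh

variable {μ : Measure ℝ} {a b : ℝ}

theorem monotone_uniformMesh (hab : a ≤ b) (n : ℕ) : Monotone (uniformMesh a b n) := by
  intro i j hij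
  have : 0 ≤ (b - a) / n := div_nonneg (sub_nonneg.2 hab) (Nat.cast_nonneg n)
  unfold uniformMesh
  gcongr

theorem uniformMesh_last {n : ℕ} (hn : 1 ≤ n) : uniformMesh a b n n = b := by
  have : (n : ℝ) ≠ 0 := by positivity
  unfold uniformMesh
  field_simp
  ring

theorem isProbabilityMeasure_discretize [IsProbabilityMeasure μ] (hab : a < b)
    (hμ : μ.support ⊆ Set.Icc a b) {n : ℕ} (hn : 1 ≤ n) :
    IsProbabilityMeasure (discretize μ (uniformMesh a b n) n) :=
  ⟨by rw [discretize_univ (monotone_uniformMesh hab.le n), uniformMesh_last hn,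
    cdf_eq_one_of_le hμ le_rfl, ENNReal.ofReal_one]⟩

theorem cdf_discretize_le [IsProbabilityMeasure μ] (hab : a < b)
    (hμ : μ.support ⊆ Set.Icc a b) {n : ℕ} (hn : 1 ≤ n) (y : ℝ) :
    cdf (discretize μ (uniformMesh a b n) n) y ≤ cdf μ y := by
  have := isProbabilityMeasure_discretize hab hμ hn
  rw [← ENNReal.ofReal_le_ofReal_iff (cdf_nonneg μ y), ofReal_cdf (discretize _ _ _)]
  exact (discretize_Iic_le (monotone_uniformMesh hab.le n) n y).trans
    (ENNReal.ofReal_le_ofReal (monotone_cdf μ (min_le_left _ _)))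

/-- Rounding up moves mass by at most one mesh step: some mesh point lies at or above `y` within
that distance, unless `y` is outside `[a, b]`, where the bound is trivial. -/
theorem cdf_le_cdf_discretize [IsProbabilityMeasure μ] (hab : a < b)
    (hμ : μ.support ⊆ Set.Icc a b) {n : ℕ} (hn : 1 ≤ n) (y : ℝ) :
    cdf μ y ≤ cdf (discretize μ (uniformMesh a b n) n) (y + (b - a) / n) := by
  have := isProbabilityMeasure_discretize hab hμ hn
  have hn0 : (0 : ℝ) < n := by exact_mod_cast hn
  have hh : 0 < (b - a) / n := div_pos (sub_pos.2 hab) hn0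
  rcases lt_or_ge y a with hy | hy
  · rw [cdf_eq_zero_of_lt hμ hy]
    exact cdf_nonneg _ _
  suffices h : ∃ j ≤ n, cdf μ y ≤ cdf μ (uniformMesh a b n j) ∧
      uniformMesh a b n j ≤ y + (b - a) / n by
    obtain ⟨j, hj, h1, h2⟩ := h
    refine h1.trans ?_
    rw [← ENNReal.ofReal_le_ofReal_iff (cdf_nonneg _ _), ofReal_cdf (discretize _ _ _)]
    exact le_discretize_Iic (monotone_uniformMesh hab.le n) hj h2
  rcases le_or_gt y b with hyb | hyb
  · have h0 : 0 ≤ (y - a) / ((b - a) / n) := div_nonneg (sub_nonneg.2 hy) hh.le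
    -- Index of the first mesh point at or above `y`.
    refine ⟨⌈(y - a) / ((b - a) / n)⌉₊, ?_, monotone_cdf μ ?_, ?_⟩
    · rw [Nat.ceil_le, div_le_iff₀ hh, mul_div_cancel₀ _ hn0.ne']
      linarith
    · have := Nat.le_ceil ((y - a) / ((b - a) / n))
      rw [div_le_iff₀ hh] at this
      unfold uniformMesh
      linarith
    · have := Nat.ceil_lt_add_one h0
      rw [← sub_lt_iff_lt_add, lt_div_iff₀ hh] at this
      unfold uniformMesh
      linarith
  · refine ⟨n, le_rfl, ?_, ?_⟩
    · rw [uniformMesh_last hn, cdf_eq_one_of_le hμ le_rfl]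
      exact cdf_le_one _ _
    · rw [uniformMesh_last hn]
      linarith

theorem abs_quantile_discretize_sub_le [IsProbabilityMeasure μ] (hab : a < b)
    (hμ : μ.support ⊆ Set.Icc a b) {n : ℕ} (hn : 1 ≤ n) {u : ℝ} (hu : u ∈ Set.Ioo (0 : ℝ) 1) :
    |quantile (discretize μ (uniformMesh a b n) n) u - quantile μ u| ≤ (b - a) / n := by
  have h1 : quantile μ u ≤ quantile (discretize μ (uniformMesh a b n) n) u := by
    rw [quantile_le_iff_of_mem_Ioo hu]
    exact ((quantile_le_iff_of_mem_Ioo hu).1 le_rfl).trans (cdf_discretize_le hab hμ hn _)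
  have h2 : quantile (discretize μ (uniformMesh a b n) n) u ≤ quantile μ u + (b - a) / n := by
    rw [quantile_le_iff_of_mem_Ioo hu]
    exact ((quantile_le_iff_of_mem_Ioo hu).1 le_rfl).trans (cdf_le_cdf_discretize hab hμ hn _)
  rw [abs_of_nonneg (sub_nonneg.2 h1)]
  linarith

end UniformMesh

/-! ### Cosine series and their real parts. -/

/-- The `k`-th Fourier cosine coefficient of a function on `(-π, π)`. -/
noncomputable def cosCoeff (φ : ℝ → ℝ) (k : ℕ) : ℝ :=
  (1 / Real.pi) * ∫ θ in (-Real.pi)..Real.pi, φ θ * Real.cos (k * θ)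

/-- The power series whose coefficients are the Fourier cosine coefficients of `φ`, without the
constant term. -/
noncomputable def cosSeries (φ : ℝ → ℝ) (z : ℂ) : ℂ :=
  ∑' k : ℕ, (cosCoeff φ (k + 1) : ℂ) * z ^ (k + 1)

/-- Lebesgue measure on `(-π, π]`. -/
noncomputable abbrev circleVolume : Measure ℝ := volume.restrict (Set.Ioc (-Real.pi) Real.pi)

theorem cosCoeff_eq_integral (φ : ℝ → ℝ) (k : ℕ) :
    cosCoeff φ k = (1 / Real.pi) * ∫ θ, φ θ * Real.cos (k * θ) ∂circleVolume := by
  rw [cosCoeff, intervalIntegral.integral_of_le (by linarith [Real.pi_pos])]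

theorem integral_circleVolume_const (c : ℝ) : ∫ _, c ∂circleVolume = 2 * Real.pi * c := by
  rw [← intervalIntegral.integral_of_le (by linarith [Real.pi_pos]),
    intervalIntegral.integral_const, smul_eq_mul]
  ring

theorem cosCoeff_one (k : ℕ) : cosCoeff (fun _ => 1) (k + 1) = 0 := by
  have hk : ((k + 1 : ℕ) : ℝ) ≠ 0 := by positivity
  have h : ∫ θ in (-Real.pi)..Real.pi, Real.cos ((k + 1 : ℕ) * θ) = 0 := by
    rw [intervalIntegral.integral_comp_mul_left (fun x => Real.cos x) hk, integral_cos]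
    simp only [mul_neg, Real.sin_neg, Real.sin_nat_mul_pi]
    simp
  simp only [cosCoeff, one_mul, h, mul_zero]

variable {φ ψ : ℝ → ℝ} {M : ℝ}

theorem integrable_of_ae_abs_le (hφ : AEStronglyMeasurable φ circleVolume)
    (hM : ∀ᵐ t ∂circleVolume, |φ t| ≤ M) : Integrable φ circleVolume :=
  Integrable.of_bound hφ M hM

theorem Integrable.mul_cos (hφ : Integrable φ circleVolume) (c : ℝ) :
    Integrable (fun t => φ t * Real.cos (c * t)) circleVolume :=
  hφ.mul_bdd (c := 1) (by fun_prop)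
    (Filter.Eventually.of_forall fun t => by simpa using Real.abs_cos_le_one (c * t))

theorem cosCoeff_sub (hφ : Integrable φ circleVolume) (hψ : Integrable ψ circleVolume) (k : ℕ) :
    cosCoeff (fun t => φ t - ψ t) k = cosCoeff φ k - cosCoeff ψ k := by
  simp only [cosCoeff_eq_integral, sub_mul]
  rw [integral_sub (Integrable.mul_cos hφ _) (Integrable.mul_cos hψ _), mul_sub]

theorem abs_cosCoeff_le (hM : ∀ᵐ t ∂circleVolume, |φ t| ≤ M) (k : ℕ) :
    |cosCoeff φ k| ≤ 2 * M := by
  have h : ‖∫ θ, φ θ * Real.cos (k * θ) ∂circleVolume‖ ≤ M * circleVolume.real Set.univ := by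
    refine norm_integral_le_of_norm_le_const ?_
    filter_upwards [hM] with t ht
    rw [norm_mul, Real.norm_eq_abs, Real.norm_eq_abs]
    exact (mul_le_of_le_one_right (abs_nonneg _) (Real.abs_cos_le_one _)).trans ht
  have hv : circleVolume.real Set.univ = 2 * Real.pi := by
    have := integral_circleVolume_const 1
    simpa using this
  rw [hv, Real.norm_eq_abs] at h
  rw [cosCoeff_eq_integral, abs_mul, abs_of_pos (by positivity : (0 : ℝ) < 1 / Real.pi)]
  calc _ ≤ 1 / Real.pi * (M * (2 * Real.pi)) := by gcongr
    _ = 2 * M := by field_simp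

theorem summable_pow_succ {r : ℝ} (hr0 : 0 ≤ r) (hr : r < 1) :
    Summable fun k : ℕ => r ^ (k + 1) :=
  (summable_nat_add_iff 1).2 (summable_geometric_of_lt_one hr0 hr)

theorem norm_cosSeries_term_le (hM : ∀ᵐ t ∂circleVolume, |φ t| ≤ M) {r : ℝ} {z : ℂ}
    (hz : ‖z‖ ≤ r) (k : ℕ) :
    ‖(cosCoeff φ (k + 1) : ℂ) * z ^ (k + 1)‖ ≤ 2 * M * r ^ (k + 1) := by
  have h := abs_cosCoeff_le hM (k + 1)
  have hM0 : 0 ≤ 2 * M := (abs_nonneg _).trans h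
  rw [norm_mul, norm_pow, Complex.norm_real, Real.norm_eq_abs]
  gcongr

theorem summable_cosSeries (hM : ∀ᵐ t ∂circleVolume, |φ t| ≤ M) {z : ℂ} (hz : ‖z‖ < 1) :
    Summable fun k : ℕ => (cosCoeff φ (k + 1) : ℂ) * z ^ (k + 1) :=
  Summable.of_norm_bounded ((summable_pow_succ (norm_nonneg z) hz).mul_left (2 * M))
    fun k => norm_cosSeries_term_le hM le_rfl k

theorem differentiableOn_cosSeries (hM : ∀ᵐ t ∂circleVolume, |φ t| ≤ M) :
    DifferentiableOn ℂ (cosSeries φ) (Metric.ball 0 1) := by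
  intro z hz
  rw [mem_ball_zero_iff] at hz
  obtain ⟨r, hzr, hr⟩ := exists_between hz
  have h : DifferentiableOn ℂ (cosSeries φ) (Metric.ball 0 r) :=
    Complex.differentiableOn_tsum_of_summable_norm
      ((summable_pow_succ ((norm_nonneg z).trans hzr.le) hr).mul_left (2 * M))
      (fun k => by fun_prop) Metric.isOpen_ball
      fun k w hw => norm_cosSeries_term_le hM (mem_ball_zero_iff.1 hw).le k
  exact (h.differentiableAt
    (Metric.isOpen_ball.mem_nhds (mem_ball_zero_iff.2 hzr))).differentiableWithinAt

theorem cosSeries_zero (φ : ℝ → ℝ) : cosSeries φ 0 = 0 := by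
  simp [cosSeries]

theorem cosSeries_sub {N : ℝ} (hφ : AEStronglyMeasurable φ circleVolume)
    (hM : ∀ᵐ t ∂circleVolume, |φ t| ≤ M) (hψ : AEStronglyMeasurable ψ circleVolume)
    (hN : ∀ᵐ t ∂circleVolume, |ψ t| ≤ N) {z : ℂ} (hz : ‖z‖ < 1) :
    cosSeries (fun t => φ t - ψ t) z = cosSeries φ z - cosSeries ψ z := by
  rw [cosSeries, cosSeries, cosSeries,
    ← (summable_cosSeries hM hz).tsum_sub (summable_cosSeries hN hz)]
  congr 1 with k
  rw [cosCoeff_sub (integrable_of_ae_abs_le hφ hM) (integrable_of_ae_abs_le hψ hN)]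
  push_cast
  ring

/-- The real part of the kernel `∑_{k ≥ 1} cos(kt) z^k`. -/
noncomputable def cosKernel (z : ℂ) (t : ℝ) : ℝ :=
  ∑' k : ℕ, Real.cos ((k + 1 : ℕ) * t) * (z ^ (k + 1)).re

theorem abs_cosKernel_term_le (z : ℂ) (t : ℝ) (k : ℕ) :
    |Real.cos ((k + 1 : ℕ) * t) * (z ^ (k + 1)).re| ≤ ‖z‖ ^ (k + 1) := by
  rw [abs_mul, ← norm_pow]
  exact (mul_le_of_le_one_left (abs_nonneg _) (Real.abs_cos_le_one _)).trans
    (Complex.abs_re_le_norm _)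

theorem hasSum_cosKernel {z : ℂ} (hz : ‖z‖ < 1) (t : ℝ) :
    HasSum (fun k : ℕ => Real.cos ((k + 1 : ℕ) * t) * (z ^ (k + 1)).re) (cosKernel z t) :=
  (Summable.of_norm_bounded (summable_pow_succ (norm_nonneg z) hz)
    (abs_cosKernel_term_le z t)).hasSum

/-- `w / (1 - w) + 1 / 2` is half of `(1 + w) / (1 - w)`, which has positive real part on the disc.
-/
theorem neg_half_le_re_div_one_sub {w : ℂ} (hw : ‖w‖ < 1) : -(1 / 2) ≤ (w / (1 - w)).re := by
  have hne : 1 - w ≠ 0 := by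
    intro h
    rw [← sub_eq_zero.1 h] at hw
    simp at hw
  have hpos : 0 < Complex.normSq (1 - w) := Complex.normSq_pos.2 hne
  have hsq : w.re * w.re + w.im * w.im < 1 := by
    rw [← Complex.normSq_apply, Complex.normSq_eq_norm_sq]
    nlinarith [norm_nonneg w]
  rw [Complex.div_re, ← add_div, le_div_iff₀ hpos, Complex.normSq_apply]
  simp only [Complex.sub_re, Complex.sub_im, Complex.one_re, Complex.one_im]
  nlinarith

theorem hasSum_pow_succ {w : ℂ} (hw : ‖w‖ < 1) :
    HasSum (fun k : ℕ => w ^ (k + 1)) (w / (1 - w)) := by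
  simpa [pow_succ', div_eq_mul_inv] using (hasSum_geometric_of_norm_lt_one hw).mul_left w

/-- Writing the cosine by exponentials, the kernel is the average of `Re (w / (1 - w))` over `w =
e^{± it} z`. -/
theorem neg_half_le_cosKernel {z : ℂ} (hz : ‖z‖ < 1) (t : ℝ) : -(1 / 2) ≤ cosKernel z t := by
  set w₁ : ℂ := Complex.exp (t * Complex.I) * z with hw₁
  set w₂ : ℂ := Complex.exp ((-t : ℝ) * Complex.I) * z with hw₂
  have h₁ : ‖w₁‖ < 1 := by rwa [hw₁, norm_mul, Complex.norm_exp_ofReal_mul_I, one_mul]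
  have h₂ : ‖w₂‖ < 1 := by rwa [hw₂, norm_mul, Complex.norm_exp_ofReal_mul_I, one_mul]
  have hs := ((Complex.hasSum_re (hasSum_pow_succ h₁)).add
    (Complex.hasSum_re (hasSum_pow_succ h₂))).mul_left (1 / 2)
  have hterm : ∀ k : ℕ, 1 / 2 * ((w₁ ^ (k + 1)).re + (w₂ ^ (k + 1)).re) =
      Real.cos ((k + 1 : ℕ) * t) * (z ^ (k + 1)).re := by
    intro k
    have hexp : w₁ ^ (k + 1) + w₂ ^ (k + 1) =
        ((2 * Real.cos ((k + 1 : ℕ) * t) : ℝ) : ℂ) * z ^ (k + 1) := by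
      rw [hw₁, hw₂, mul_pow, mul_pow, ← Complex.exp_nat_mul, ← Complex.exp_nat_mul, ← add_mul]
      congr 1
      push_cast
      rw [Complex.two_cos]
      congr 2 <;> ring
    rw [← Complex.add_re, hexp, Complex.re_ofReal_mul]
    ring
  simp only [hterm] at hs
  rw [(hasSum_cosKernel hz t).unique hs]
  linarith [neg_half_le_re_div_one_sub h₁, neg_half_le_re_div_one_sub h₂]

theorem continuous_cosKernel {z : ℂ} (hz : ‖z‖ < 1) : Continuous (cosKernel z) :=
  continuous_tsum (fun k => by fun_prop) (summable_pow_succ (norm_nonneg z) hz)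
    fun k t => abs_cosKernel_term_le z t k

theorem re_cosSeries_eq_integral (hφ : AEStronglyMeasurable φ circleVolume)
    (hM : ∀ᵐ t ∂circleVolume, |φ t| ≤ M) {z : ℂ} (hz : ‖z‖ < 1) :
    (cosSeries φ z).re = (1 / Real.pi) * ∫ t, φ t * cosKernel z t ∂circleVolume := by
  have hsum : HasSum (fun k : ℕ => ∫ t, φ t * (Real.cos ((k + 1 : ℕ) * t) * (z ^ (k + 1)).re)
      ∂circleVolume) (∫ t, φ t * cosKernel z t ∂circleVolume) := by
    refine hasSum_integral_of_dominated_convergence (fun k _ => M * ‖z‖ ^ (k + 1))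
      (fun k => hφ.mul (by fun_prop)) (fun k => ?_) ?_ (integrable_const _) ?_
    · filter_upwards [hM] with t ht
      rw [norm_mul]
      exact mul_le_mul ht (abs_cosKernel_term_le z t k) (norm_nonneg _) ((abs_nonneg _).trans ht)
    · exact Filter.Eventually.of_forall fun _ =>
        (summable_pow_succ (norm_nonneg z) hz).mul_left M
    · exact Filter.Eventually.of_forall fun t => (hasSum_cosKernel hz t).mul_left _
  have hre := Complex.hasSum_re (summable_cosSeries hM hz).hasSum
  refine hre.unique ?_
  convert! hsum.mul_left (1 / Real.pi) using 2 with k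
  rw [Complex.re_ofReal_mul, cosCoeff_eq_integral, mul_assoc, ← integral_mul_const]
  simp only [mul_assoc]

/-- The integral representation at `φ = 1`, whose cosine coefficients of positive order vanish. -/
theorem integral_cosKernel {z : ℂ} (hz : ‖z‖ < 1) : ∫ t, cosKernel z t ∂circleVolume = 0 := by
  have h := re_cosSeries_eq_integral (φ := fun _ => 1) (M := 1) aestronglyMeasurable_const
    (by simp) hz
  simp only [cosSeries, cosCoeff_one, one_mul] at h
  simpa [Real.pi_ne_zero] using h.symm

/-- The real part of the analytic function generated by a bounded `φ` is bounded on the disc. -/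
theorem abs_re_cosSeries_le (hφ : AEStronglyMeasurable φ circleVolume)
    (hM : ∀ᵐ t ∂circleVolume, |φ t| ≤ M) {z : ℂ} (hz : ‖z‖ < 1) :
    |(cosSeries φ z).re| ≤ 2 * M := by
  have hint : Integrable (cosKernel z) circleVolume :=
    (continuous_cosKernel hz).integrableOn_Ioc
  have h : ‖∫ t, φ t * cosKernel z t ∂circleVolume‖ ≤
      ∫ t, M * (cosKernel z t + 1) ∂circleVolume := by
    refine norm_integral_le_of_norm_le ((hint.add (integrable_const 1)).const_mul M) ?_
    filter_upwards [hM] with t ht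
    rw [norm_mul]
    refine mul_le_mul ht ?_ (norm_nonneg _) ((abs_nonneg _).trans ht)
    -- A kernel `K ≥ -1/2` satisfies `|K| ≤ K + 1`, and `K + 1` has integral `2π`.
    have := neg_half_le_cosKernel hz t
    exact abs_le.2 ⟨by linarith, by linarith⟩
  rw [integral_const_mul, integral_add hint (integrable_const 1), integral_cosKernel hz,
    integral_circleVolume_const, Real.norm_eq_abs] at h
  rw [re_cosSeries_eq_integral hφ hM hz, abs_mul,
    abs_of_pos (by positivity : (0 : ℝ) < 1 / Real.pi)]
  calc _ ≤ 1 / Real.pi * (M * (0 + 2 * Real.pi * 1)) := by gcongr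
    _ = 2 * M := by field_simp; ring

/-! ### Hardy bounds for cosine series and Gross maps. -/

theorem hardyNorm_congr {p : ℝ} {f g : ℂ → ℂ} (h : Set.EqOn f g (Metric.ball 0 1)) :
    hardyNorm p f = hardyNorm p g := by
  refine iSup_congr fun r => iSup_congr fun hr => ?_
  have hfg : ∀ θ : ℝ, f ((r : ℂ) * Complex.exp (θ * Complex.I)) =
      g ((r : ℂ) * Complex.exp (θ * Complex.I)) := fun θ => h (by
    simpa [Complex.norm_exp_ofReal_mul_I, abs_of_nonneg hr.1] using hr.2)
  simp only [hfg]

/-- The constant in the bound of the Hardy norm of `cosSeries φ` by the supremum of `|φ|`. -/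
noncomputable def hardyConst (p : ℝ) : ℝ := p * (2 * Real.exp 1 / Real.cos 1) ^ (1 / p) * 2

theorem hardyNorm_cosSeries_le {p : ℝ} (hp : 0 < p) {φ : ℝ → ℝ} {M : ℝ} (hM0 : 0 < M)
    (hφ : AEStronglyMeasurable φ circleVolume) (hM : ∀ᵐ t ∂circleVolume, |φ t| ≤ M) :
    hardyNorm p (cosSeries φ) ≤ ENNReal.ofReal (hardyConst p * M) := by
  have h := hardyNorm_le_of_abs_re_le hp (mul_pos two_pos hM0) (differentiableOn_cosSeries hM)
    (cosSeries_zero φ) fun z hz => abs_re_cosSeries_le hφ hM (mem_ball_zero_iff.1 hz)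
  rwa [← mul_assoc] at h

theorem memHardy_cosSeries {p : ℝ} (hp : 0 < p) {φ : ℝ → ℝ} {M : ℝ} (hM0 : 0 < M)
    (hφ : AEStronglyMeasurable φ circleVolume) (hM : ∀ᵐ t ∂circleVolume, |φ t| ≤ M) :
    MemHardy p (cosSeries φ) :=
  ⟨differentiableOn_cosSeries hM,
    (hardyNorm_cosSeries_le hp hM0 hφ hM).trans_lt ENNReal.ofReal_lt_top⟩

theorem ae_abs_phi_le {μ : Measure ℝ} [IsProbabilityMeasure μ] {a b : ℝ}
    (hμ : μ.support ⊆ Set.Icc a b) : ∀ᵐ t ∂circleVolume, |phi μ t| ≤ max |a| |b| := by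
  filter_upwards [ae_abs_div_pi_mem_Ioo] with t ht
  exact abs_le_max_abs_abs (quantile_mem_Icc hμ ht).1 (quantile_mem_Icc hμ ht).2

theorem ae_abs_phi_discretize_sub_le {μ : Measure ℝ} [IsProbabilityMeasure μ] {a b : ℝ}
    (hab : a < b) (hμ : μ.support ⊆ Set.Icc a b) {n : ℕ} (hn : 1 ≤ n) :
    ∀ᵐ t ∂circleVolume,
      |phi (discretize μ (uniformMesh a b n) n) t - phi μ t| ≤ (b - a) / n := by
  filter_upwards [ae_abs_div_pi_mem_Ioo] with t ht
  exact abs_quantile_discretize_sub_le hab hμ hn ht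

theorem ae_abs_phi_discretize_le {μ : Measure ℝ} [IsProbabilityMeasure μ] {a b : ℝ}
    (hab : a < b) (hμ : μ.support ⊆ Set.Icc a b) {n : ℕ} (hn : 1 ≤ n) :
    ∀ᵐ t ∂circleVolume,
      |phi (discretize μ (uniformMesh a b n) n) t| ≤ max |a| |b| + (b - a) / n := by
  filter_upwards [ae_abs_phi_le hμ, ae_abs_phi_discretize_sub_le hab hμ hn] with t h1 h2
  have := abs_sub_abs_le_abs_sub (phi (discretize μ (uniformMesh a b n) n) t) (phi μ t)
  linarith

end GrossMap

theorem corollary16 (μ : Measure ℝ) [IsProbabilityMeasure μ] (a b : ℝ) (hab : a < b)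
    (hμ : μ.support ⊆ Set.Icc a b) (p : ℝ) (hp : 1 < p) :
    GrossMap.MemHardy p (GrossMap.gross μ) ∧
    (∀ n : ℕ, 1 ≤ n → GrossMap.MemHardy p
      (GrossMap.gross (GrossMap.discretize μ (GrossMap.uniformMesh a b n) n))) ∧
    ∃ C : ℝ≥0, ∀ n : ℕ, 1 ≤ n →
      GrossMap.hardyNorm p (fun z : ℂ =>
        GrossMap.gross (GrossMap.discretize μ (GrossMap.uniformMesh a b n) n) z
          - GrossMap.gross μ z) ≤ (C : ℝ≥0∞) / (n : ℝ≥0∞) := by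
  have hp0 : 0 < p := one_pos.trans hp
  have hmesh : ∀ {n : ℕ}, 1 ≤ n → 0 < (b - a) / n := fun hn =>
    div_pos (sub_pos.2 hab) (by exact_mod_cast hn)
  have hmax : 0 < max |a| |b| := by
    by_contra! h
    have ha := abs_nonpos_iff.1 ((le_max_left _ _).trans h)
    have hb := abs_nonpos_iff.1 ((le_max_right _ _).trans h)
    exact hab.ne (ha.trans hb.symm)
  -- `gross ν` is definitionally `cosSeries (phi ν)`.
  refine ⟨GrossMap.memHardy_cosSeries hp0 hmax (GrossMap.aestronglyMeasurable_phi μ)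
    (GrossMap.ae_abs_phi_le hμ), fun n hn => GrossMap.memHardy_cosSeries hp0
    (add_pos hmax (hmesh hn)) (GrossMap.aestronglyMeasurable_phi _)
    (GrossMap.ae_abs_phi_discretize_le hab hμ hn),
    Real.toNNReal (GrossMap.hardyConst p * (b - a)), fun n hn => ?_⟩
  have hn0 : (0 : ℝ) < n := by exact_mod_cast hn
  have h := GrossMap.hardyNorm_cosSeries_le hp0 (hmesh hn)
    ((GrossMap.aestronglyMeasurable_phi _).sub (GrossMap.aestronglyMeasurable_phi μ))
    (GrossMap.ae_abs_phi_discretize_sub_le hab hμ hn)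
  rw [← mul_div_assoc, ENNReal.ofReal_div_of_pos hn0, ENNReal.ofReal_natCast] at h
  -- The series are subtracted termwise only inside the disc, where they are known to converge.
  refine le_trans (GrossMap.hardyNorm_congr fun z hz => ?_).le h
  exact (GrossMap.cosSeries_sub (GrossMap.aestronglyMeasurable_phi _)
    (GrossMap.ae_abs_phi_discretize_le hab hμ hn) (GrossMap.aestronglyMeasurable_phi μ)
    (GrossMap.ae_abs_phi_le hμ) (mem_ball_zero_iff.1 hz)).symm
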